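/- An Orlicz function is a convex, left-continuous function $\varphi:[0,\infty)\to[0,\infty]$ with $\varphi(0)=0$ that is neither identically $0$ nor identically $\infty$ on $(0,\infty)$. Its complementary function is $\varphi_*(u)=\sup_{v\ge 0}\{uv-\varphi(v)\}$, $u\ge 0$. For $\psi:[0,\infty)\to[0,\infty]$ put \[ d_\psi=\sup\{u\ge 0:\ \exists k>0\ \forall v\in[0,u]\ \ \psi(v)=kv\},\qquad c_\psi=\sup\{u\ge 0:\psi(u)\le 1\},\qquad b_\psi=\sup\{u\ge 0:\psi(u)<\infty\}, \] suprema in $[0,\infty]$, with the conventions $\psi(\infty)=\lim_{u\to\infty}\psi(u)$ for nondecreasing $\psi$, and $0\cdot\infty=0$. Let $(\Omega,\Sigma,\mu)$ be a $\sigma$-finite measure space, and write $I_\psi(f)=\int_\Omega \psi(|f|)\,d\mu$ for measurable $f:\Omega\to\mathbb{R}$. The space $L_\varphi^0(\mu)$ consists of all (classes, modulo equality a.e., of) measurable $f:\Omega\to\mathbb{R}$ with $I_\varphi(\lambda f)<\infty$ for some $\lambda>0$, equipped with the Orlicz norm \[ \|f\|_\varphi^0=\sup\Big\{\int_\Omega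 fg\,d\mu:\ I_{\varphi_*}(g)\le 1\Big\}. \] When $\mu$ is the counting measure on $\mathbb{N}$ the space is denoted by $\ell_\varphi^0$. The measure $\mu$ is non-atomic if every $A\in\Sigma$ with $\mu(A)>0$ contains some $B\in\Sigma$ with $0<\mu(B)<\mu(A)$. A real normed space $X$ has the local diameter two property if for every $x^*\in X^*$ with $\|x^*\|=1$ and every $\epsilon>0$ the slice $\{x\in X:\|x\|\le 1,\ x^*(x)>1-\epsilon\}$ has diameter $2$. \textbf{Theorem.} Let $\varphi$ be an Orlicz function. (i) Let $\mu$ be a $\sigma$-finite non-atomic measure. If $d_{\varphi_*}<b_{\varphi_*}$ and $\varphi_*(b_{\varphi_*})\,\mu(\Omega)>1$, then $L_\varphi^0(\mu)$ does not have the local diameter two property. (ii) If $d_{\varphi_*}<c_{\varphi_*}$ and $\varphi_*(c_{\varphi_*})=1$, then $\ell_\varphi^0$ does not have the local diameter two property. -/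

import Mathlib

open MeasureTheory Set
open scoped NNReal ENNReal Topology

noncomputable section

/-- An Orlicz function `φ : [0, ∞) → [0, ∞]`: convex, `φ 0 = 0`, left-continuous, and
neither identically zero nor identically infinite on `(0, ∞)`. -/
structure OrliczFunction where
  toFun : ℝ≥0 → ℝ≥0∞
  convexOn' : ConvexOn ℝ≥0 univ toFun
  map_zero' : toFun 0 = 0
  leftContinuous' : ∀ u : ℝ≥0, 0 < u → ContinuousWithinAt toFun (Iic u) u
  exists_ne_zero' : ∃ u : ℝ≥0, 0 < u ∧ toFun u ≠ 0
  exists_ne_top' : ∃ u : ℝ≥0, 0 < u ∧ toFun u ≠ ∞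

namespace Orlicz

/-- The complementary function `φ_*(u) = sup_{v ≥ 0} (u v - φ(v))`. The subtraction in `[0, ∞]`
is truncated at zero; this does not change the supremum, as `v = 0` contributes `0`. -/
def complementary (φ : ℝ≥0 → ℝ≥0∞) (u : ℝ≥0) : ℝ≥0∞ :=
  ⨆ v : ℝ≥0, ((u : ℝ≥0∞) * (v : ℝ≥0∞) - φ v)

/-- `d_φ`: the supremum of all `u` such that `φ` is linear (with a positive slope) on `[0, u]`. -/
def linearBound (φ : ℝ≥0 → ℝ≥0∞) : ℝ≥0∞ :=
  sSup {x : ℝ≥0∞ | ∃ u : ℝ≥0, x = u ∧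
    ∃ k : ℝ≥0, 0 < k ∧ ∀ v : ℝ≥0, v ≤ u → φ v = (k : ℝ≥0∞) * (v : ℝ≥0∞)}

/-- `c_φ = sup {u : φ(u) ≤ 1}`. -/
def unitBound (φ : ℝ≥0 → ℝ≥0∞) : ℝ≥0∞ :=
  sSup {x : ℝ≥0∞ | ∃ u : ℝ≥0, x = u ∧ φ u ≤ 1}

/-- `b_φ = sup {u : φ(u) < ∞}`. -/
def finiteBound (φ : ℝ≥0 → ℝ≥0∞) : ℝ≥0∞ :=
  sSup {x : ℝ≥0∞ | ∃ u : ℝ≥0, x = u ∧ φ u < ∞}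

/-- The value of a nondecreasing `φ` at a point of `[0, ∞]`, with
`φ(∞) = lim_{u → ∞} φ(u) = sup_u φ(u)`. -/
def extend (φ : ℝ≥0 → ℝ≥0∞) (x : ℝ≥0∞) : ℝ≥0∞ :=
  if x = ∞ then ⨆ u : ℝ≥0, φ u else φ x.toNNReal

variable {Ω : Type*} [MeasurableSpace Ω]

/-- The modular `I_φ(f) = ∫ φ(|f|) dμ`. -/
def modular (φ : ℝ≥0 → ℝ≥0∞) (μ : Measure Ω) (f : Ω → ℝ) : ℝ≥0∞ :=
  ∫⁻ t, φ ‖f t‖₊ ∂μ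

/-- A measure is non-atomic if every measurable set of positive measure contains a measurable
subset of strictly smaller positive measure. -/
def IsNonatomic (μ : Measure Ω) : Prop :=
  ∀ A : Set Ω, MeasurableSet A → 0 < μ A →
    ∃ B : Set Ω, MeasurableSet B ∧ B ⊆ A ∧ 0 < μ B ∧ μ B < μ A

end Orlicz

namespace OrliczFunction

open Orlicz

variable (φ : OrliczFunction)

theorem map_mul_le (a u : ℝ≥0) (ha : a ≤ 1) : φ.toFun (a * u) ≤ a * φ.toFun u := by
  have h := φ.convexOn'.2 (mem_univ u) (mem_univ 0) (zero_le : 0 ≤ a) (zero_le : 0 ≤ 1 - a)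
    (add_tsub_cancel_of_le ha)
  simpa [φ.map_zero', ENNReal.smul_def] using h

theorem mono : Monotone φ.toFun := by
  intro u v huv
  rcases eq_or_ne v 0 with rfl | hv
  · simp [nonpos_iff_eq_zero.mp huv]
  · have h1 : u / v ≤ 1 := div_le_one_of_le₀ huv zero_le
    have h := φ.map_mul_le (u / v) v h1
    rw [div_mul_cancel₀ _ hv] at h
    refine h.trans ?_
    calc ((u / v : ℝ≥0) : ℝ≥0∞) * φ.toFun v ≤ 1 * φ.toFun v := by
          gcongr
          exact_mod_cast h1
      _ = φ.toFun v := one_mul _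

/-- Young's inequality. -/
theorem young (u v : ℝ≥0) :
    ((u * v : ℝ≥0) : ℝ≥0∞) ≤ φ.toFun u + complementary φ.toFun v := by
  have h : (v : ℝ≥0∞) * (u : ℝ≥0∞) - φ.toFun u ≤ complementary φ.toFun v :=
    le_iSup (fun w : ℝ≥0 => (v : ℝ≥0∞) * (w : ℝ≥0∞) - φ.toFun w) u
  rw [tsub_le_iff_left] at h
  rw [mul_comm, ENNReal.coe_mul]
  exact h

theorem compl_zero : complementary φ.toFun 0 = 0 := by simp [complementary]

theorem compl_mul_le (a u : ℝ≥0) (ha : a ≤ 1) :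
    complementary φ.toFun (a * u) ≤ a * complementary φ.toFun u := by
  refine iSup_le fun v => ?_
  rw [tsub_le_iff_left]
  have h := φ.young v u
  calc ((a * u : ℝ≥0) : ℝ≥0∞) * (v : ℝ≥0∞) = a * ((v * u : ℝ≥0) : ℝ≥0∞) := by
        push_cast; ring
    _ ≤ a * (φ.toFun v + complementary φ.toFun u) := by gcongr
    _ = a * φ.toFun v + a * complementary φ.toFun u := mul_add _ _ _
    _ ≤ φ.toFun v + a * complementary φ.toFun u := by
        gcongr
        calc (a : ℝ≥0∞) * φ.toFun v ≤ 1 * φ.toFun v := by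
              gcongr
              exact_mod_cast ha
          _ = φ.toFun v := one_mul _

theorem exists_compl_ne_top : ∃ t : ℝ≥0, 0 < t ∧ complementary φ.toFun t ≠ ∞ := by
  obtain ⟨u, hu, hφ⟩ := φ.exists_ne_zero'
  obtain ⟨c, hc0, hc⟩ : ∃ c : ℝ≥0, 0 < c ∧ (c : ℝ≥0∞) ≤ φ.toFun u := by
    obtain ⟨c, hc0, hc⟩ := ENNReal.lt_iff_exists_nnreal_btwn.mp (pos_iff_ne_zero.mpr hφ)
    exact ⟨c, by exact_mod_cast hc0, hc.le⟩
  refine ⟨c / u, div_pos hc0 hu, ne_top_of_le_ne_top (ENNReal.coe_ne_top (r := c)) ?_⟩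
  refine iSup_le fun v => ?_
  rw [tsub_le_iff_left, ← ENNReal.coe_mul]
  rcases le_total v u with h | h
  · refine le_add_left ?_
    have : c / u * v ≤ c / u * u := by gcongr
    rw [div_mul_cancel₀ _ hu.ne'] at this
    exact_mod_cast this
  · refine le_add_right ?_
    have hv : 0 < v := hu.trans_le h
    have h1 := φ.map_mul_le (u / v) v (div_le_one_of_le₀ h zero_le)
    rw [div_mul_cancel₀ _ hv.ne'] at h1
    have h2 : ((v / u : ℝ≥0) : ℝ≥0∞) * c ≤ (v / u : ℝ≥0) * ((u / v : ℝ≥0) * φ.toFun v) := by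
      gcongr
      exact hc.trans h1
    rw [← mul_assoc, ← ENNReal.coe_mul, ← ENNReal.coe_mul,
      div_mul_div_cancel₀ hu.ne', div_self hv.ne', ENNReal.coe_one, one_mul] at h2
    rw [show c / u * v = v / u * c by ring]
    exact h2

variable {Ω : Type*} [MeasurableSpace Ω] (μ : Measure Ω)

theorem modular_add_lt_top {f g : Ω → ℝ} (hf : AEMeasurable f μ)
    (h1 : modular φ.toFun μ f < ∞) (h2 : modular φ.toFun μ g < ∞) :
    modular φ.toFun μ (fun t => 2⁻¹ * (f t + g t)) < ∞ := by
  have hm : AEMeasurable (fun t => φ.toFun ‖f t‖₊) μ :=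
    φ.mono.measurable.comp_aemeasurable hf.nnnorm
  refine lt_of_le_of_lt (b := ∫⁻ t, (φ.toFun ‖f t‖₊ + φ.toFun ‖g t‖₊) ∂μ) ?_ ?_
  · refine lintegral_mono fun t => ?_
    have h : ‖2⁻¹ * (f t + g t)‖₊ ≤ max ‖f t‖₊ ‖g t‖₊ := by
      rw [← NNReal.coe_le_coe]
      push_cast
      rw [norm_mul]
      have h3 := norm_add_le (f t) (g t)
      have h4 := le_max_left ‖f t‖ ‖g t‖
      have h5 := le_max_right ‖f t‖ ‖g t‖
      rw [Real.norm_of_nonneg (show (0 : ℝ) ≤ 2⁻¹ by norm_num)]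
      linarith
    refine (φ.mono h).trans ?_
    rcases max_choice ‖f t‖₊ ‖g t‖₊ with h' | h' <;> rw [h']
    · exact le_add_right le_rfl
    · exact le_add_left le_rfl
  · rw [lintegral_add_left' hm]
    exact ENNReal.add_lt_top.mpr ⟨h1, h2⟩

/-- The Orlicz space as a set of classes of measurable functions: all `f` such that
`I_φ(l f) < ∞` for some `l > 0`. -/
def orliczSubmodule : Submodule ℝ (Ω →ₘ[μ] ℝ) where
  carrier := {f | ∃ l : ℝ, 0 < l ∧ modular φ.toFun μ (fun t => l * f t) < ∞}
  zero_mem' := by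
    refine ⟨1, one_pos, ?_⟩
    have h : modular φ.toFun μ (fun t => 1 * (0 : Ω →ₘ[μ] ℝ) t) = 0 := by
      unfold modular
      rw [lintegral_congr_ae (g := fun _ => 0), lintegral_zero]
      filter_upwards [AEEqFun.coeFn_zero (α := Ω) (β := ℝ) (μ := μ)] with t ht
      simp [ht, φ.map_zero']
    rw [h]
    exact ENNReal.zero_lt_top
  add_mem' := by
    rintro f g ⟨l, hl, hf⟩ ⟨m, hm, hg⟩
    have key : ∀ (r s : ℝ) (h : Ω →ₘ[μ] ℝ), 0 < r → r ≤ s →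
        modular φ.toFun μ (fun t => s * h t) < ∞ →
        modular φ.toFun μ (fun t => r * h t) < ∞ := by
      intro r s h hr hrs hs
      refine lt_of_le_of_lt (lintegral_mono fun t => φ.mono ?_) hs
      rw [← NNReal.coe_le_coe]
      push_cast
      rw [norm_mul, norm_mul, Real.norm_of_nonneg hr.le, Real.norm_of_nonneg (hr.le.trans hrs)]
      gcongr
    have hp : 0 < min l m := lt_min hl hm
    have h1 := key _ _ f hp (min_le_left l m) hf
    have h2 := key _ _ g hp (min_le_right l m) hg
    refine ⟨2⁻¹ * min l m, by positivity, ?_⟩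
    have h3 := φ.modular_add_lt_top μ (f.aemeasurable.const_mul _) h1 h2
    refine lt_of_eq_of_lt (lintegral_congr_ae ?_) h3
    filter_upwards [AEEqFun.coeFn_add f g] with t ht
    rw [ht, Pi.add_apply]
    congr 2
    ring
  smul_mem' := by
    rintro c f ⟨l, hl, hf⟩
    have hc : 0 < |c| + 1 := by positivity
    refine ⟨l / (|c| + 1), by positivity, lt_of_le_of_lt (lintegral_mono_ae ?_) hf⟩
    filter_upwards [AEEqFun.coeFn_smul c f] with t ht
    refine φ.mono ?_
    rw [← NNReal.coe_le_coe, ht]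
    simp only [Pi.smul_apply, smul_eq_mul, coe_nnnorm, Real.norm_eq_abs, abs_mul, abs_div,
      abs_of_pos hl, abs_of_pos hc]
    rw [← mul_assoc]
    refine mul_le_mul_of_nonneg_right ?_ (abs_nonneg _)
    rw [div_mul_eq_mul_div, div_le_iff₀ hc]
    nlinarith [abs_nonneg c]

/-- The Orlicz space `L_φ⁰(μ)`; its norm, given below, is the Orlicz norm. -/
def OrliczSpace : Type _ := ↥(φ.orliczSubmodule μ)

namespace OrliczSpace

instance instAddCommGroup : AddCommGroup (φ.OrliczSpace μ) :=
  inferInstanceAs (AddCommGroup ↥(φ.orliczSubmodule μ))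

instance instModule : Module ℝ (φ.OrliczSpace μ) :=
  inferInstanceAs (Module ℝ ↥(φ.orliczSubmodule μ))

variable {φ μ}

/-- The underlying class of functions, as a linear map. -/
def toAEEqFun : φ.OrliczSpace μ →ₗ[ℝ] (Ω →ₘ[μ] ℝ) := (φ.orliczSubmodule μ).subtype

/-- The set of all `∫ f g dμ` with `I_{φ_*}(g) ≤ 1`. -/
def normSet (f : φ.OrliczSpace μ) : Set ℝ :=
  {r | ∃ g : Ω →ₘ[μ] ℝ, modular (complementary φ.toFun) μ g ≤ 1 ∧ r = ∫ t, toAEEqFun f t * g t ∂μ}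

/-- The Orlicz norm `sup {∫ f g dμ : I_{φ_*}(g) ≤ 1}`. -/
instance instNorm : Norm (φ.OrliczSpace μ) := ⟨fun f => sSup (normSet f)⟩

theorem norm_def (f : φ.OrliczSpace μ) : ‖f‖ = sSup (normSet f) := rfl

theorem lintegral_mul_le (f : φ.OrliczSpace μ) : ∃ C : ℝ≥0, ∀ g : Ω →ₘ[μ] ℝ,
    modular (complementary φ.toFun) μ g ≤ 1 → ∫⁻ t, ‖toAEEqFun f t * g t‖ₑ ∂μ ≤ C := by
  obtain ⟨l, hl, hf⟩ := f.2
  have hfin : modular φ.toFun μ (fun t => l * toAEEqFun f t) < ∞ := hf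
  set M := modular φ.toFun μ (fun t => l * toAEEqFun f t) with hM
  have hl0 : (‖l‖ₑ) ≠ 0 := by simpa using hl.ne'
  have hlt : (‖l‖ₑ) ≠ ∞ := enorm_ne_top
  have hne : ‖l‖ₑ⁻¹ * (M + 1) ≠ ∞ :=
    ENNReal.mul_ne_top (ENNReal.inv_ne_top.mpr hl0) (by simp [hfin.ne])
  refine ⟨(‖l‖ₑ⁻¹ * (M + 1)).toNNReal, fun g hg => ?_⟩
  rw [ENNReal.coe_toNNReal hne]
  have hm : AEMeasurable (fun t => φ.toFun ‖l * toAEEqFun f t‖₊) μ :=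
    φ.mono.measurable.comp_aemeasurable
      (((toAEEqFun f).aemeasurable.const_mul l).nnnorm)
  have h1 : ‖l‖ₑ * ∫⁻ t, ‖toAEEqFun f t * g t‖ₑ ∂μ ≤ M + 1 := by
    rw [← lintegral_const_mul' _ _ hlt]
    calc ∫⁻ t, ‖l‖ₑ * ‖toAEEqFun f t * g t‖ₑ ∂μ
        ≤ ∫⁻ t, (φ.toFun ‖l * toAEEqFun f t‖₊ + complementary φ.toFun ‖g t‖₊) ∂μ := by
          refine lintegral_mono fun t => ?_
          refine le_trans (le_of_eq ?_) (φ.young _ _)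
          rw [← enorm_mul, ← mul_assoc, enorm_mul, ENNReal.coe_mul]
          rfl
      _ = M + modular (complementary φ.toFun) μ g := lintegral_add_left' hm _
      _ ≤ M + 1 := by gcongr
  calc ∫⁻ t, ‖toAEEqFun f t * g t‖ₑ ∂μ
      = ‖l‖ₑ⁻¹ * (‖l‖ₑ * ∫⁻ t, ‖toAEEqFun f t * g t‖ₑ ∂μ) := by
        rw [← mul_assoc, ENNReal.inv_mul_cancel hl0 hlt, one_mul]
    _ ≤ _ := by gcongr

theorem integrable_mul (f : φ.OrliczSpace μ) {g : Ω →ₘ[μ] ℝ}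
    (hg : modular (complementary φ.toFun) μ g ≤ 1) :
    Integrable (fun t => toAEEqFun f t * g t) μ := by
  obtain ⟨C, hC⟩ := lintegral_mul_le f
  exact ⟨(toAEEqFun f).aestronglyMeasurable.mul g.aestronglyMeasurable,
    (hC g hg).trans_lt ENNReal.coe_lt_top⟩

theorem bddAbove_normSet (f : φ.OrliczSpace μ) : BddAbove (normSet f) := by
  obtain ⟨C, hC⟩ := lintegral_mul_le f
  refine ⟨C, ?_⟩
  rintro r ⟨g, hg, rfl⟩
  refine (le_abs_self _).trans ?_
  rw [← Real.norm_eq_abs]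
  have h : ‖∫ t, toAEEqFun f t * g t ∂μ‖ₑ ≤ C :=
    (enorm_integral_le_lintegral_enorm _).trans (hC g hg)
  rw [enorm_eq_nnnorm, ENNReal.coe_le_coe] at h
  exact_mod_cast h

theorem modular_congr {ψ : ℝ≥0 → ℝ≥0∞} {f g : Ω → ℝ} (h : ∀ᵐ t ∂μ, ‖f t‖₊ = ‖g t‖₊) :
    modular ψ μ f = modular ψ μ g := by
  refine lintegral_congr_ae ?_
  filter_upwards [h] with t ht
  rw [ht]

theorem zero_mem_normSet (f : φ.OrliczSpace μ) : 0 ∈ normSet f := by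
  refine ⟨0, ?_, ?_⟩
  · rw [modular_congr (g := fun _ => 0)]
    · simp [modular, φ.compl_zero]
    · filter_upwards [AEEqFun.coeFn_zero (α := Ω) (β := ℝ) (μ := μ)] with t ht
      simp [ht]
  · rw [integral_congr_ae (g := fun _ => 0), integral_zero]
    filter_upwards [AEEqFun.coeFn_zero (α := Ω) (β := ℝ) (μ := μ)] with t ht
    simp [ht]

theorem integral_le_norm (f : φ.OrliczSpace μ) {g : Ω →ₘ[μ] ℝ}
    (hg : modular (complementary φ.toFun) μ g ≤ 1) : ∫ t, toAEEqFun f t * g t ∂μ ≤ ‖f‖ :=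
  le_csSup (bddAbove_normSet f) ⟨g, hg, rfl⟩

theorem norm_le_of (f : φ.OrliczSpace μ) {r : ℝ} (h : ∀ g : Ω →ₘ[μ] ℝ,
    modular (complementary φ.toFun) μ g ≤ 1 → ∫ t, toAEEqFun f t * g t ∂μ ≤ r) : ‖f‖ ≤ r := by
  refine csSup_le ⟨0, zero_mem_normSet f⟩ ?_
  rintro _ ⟨g, hg, rfl⟩
  exact h g hg

theorem norm_nonneg' (f : φ.OrliczSpace μ) : 0 ≤ ‖f‖ :=
  le_csSup (bddAbove_normSet f) (zero_mem_normSet f)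

theorem norm_add_le' (f g : φ.OrliczSpace μ) : ‖f + g‖ ≤ ‖f‖ + ‖g‖ := by
  refine norm_le_of _ fun h hh => ?_
  have e : ∫ t, toAEEqFun (f + g) t * h t ∂μ
      = ∫ t, (toAEEqFun f t * h t + toAEEqFun g t * h t) ∂μ := by
    refine integral_congr_ae ?_
    rw [map_add]
    filter_upwards [AEEqFun.coeFn_add (toAEEqFun f) (toAEEqFun g)] with t ht
    rw [ht, Pi.add_apply, add_mul]
  rw [e, integral_add (integrable_mul f hh) (integrable_mul g hh)]
  exact add_le_add (integral_le_norm f hh) (integral_le_norm g hh)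

theorem norm_smul_le' (c : ℝ) (f : φ.OrliczSpace μ) : ‖c • f‖ ≤ |c| * ‖f‖ := by
  refine norm_le_of _ fun g hg => ?_
  have e : ∫ t, toAEEqFun (c • f) t * g t ∂μ = c * ∫ t, toAEEqFun f t * g t ∂μ := by
    rw [← integral_const_mul]
    refine integral_congr_ae ?_
    rw [map_smul]
    filter_upwards [AEEqFun.coeFn_smul c (toAEEqFun f)] with t ht
    rw [ht, Pi.smul_apply, smul_eq_mul, mul_assoc]
  rw [e]
  refine (le_abs_self _).trans ?_
  rw [abs_mul]
  refine mul_le_mul_of_nonneg_left ?_ (abs_nonneg c)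
  rw [abs_le']
  refine ⟨integral_le_norm f hg, ?_⟩
  have hn : modular (complementary φ.toFun) μ (-g : Ω →ₘ[μ] ℝ) ≤ 1 := by
    rw [modular_congr (g := g)]
    · exact hg
    · filter_upwards [AEEqFun.coeFn_neg g] with t ht
      rw [ht, Pi.neg_apply, nnnorm_neg]
  refine le_trans (le_of_eq ?_) (integral_le_norm f hn)
  rw [← integral_neg]
  refine integral_congr_ae ?_
  filter_upwards [AEEqFun.coeFn_neg g] with t ht
  rw [ht, Pi.neg_apply, mul_neg]

theorem eq_zero_of_norm_eq_zero [SigmaFinite μ] (f : φ.OrliczSpace μ) (h : ‖f‖ = 0) :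
    f = 0 := by
  by_contra hf
  have hS : MeasurableSet {t | toAEEqFun f t ≠ 0} :=
    (measurableSet_eq_fun (toAEEqFun f).measurable measurable_const).compl
  have hpos : 0 < μ {t | toAEEqFun f t ≠ 0} := by
    rw [pos_iff_ne_zero]
    intro h0
    apply hf
    apply Subtype.ext
    change toAEEqFun f = 0
    apply AEEqFun.ext
    filter_upwards [AEEqFun.coeFn_zero (α := Ω) (β := ℝ) (μ := μ), measure_eq_zero_iff_ae_notMem.mp h0]
      with t ht ht'
    rw [ht]
    simpa using ht'
  obtain ⟨A, hA, hAS, hA0, hAt⟩ := Measure.exists_subset_measure_lt_top hS hpos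
  obtain ⟨u, hu, hut⟩ := φ.exists_compl_ne_top
  obtain ⟨a, ha0, ha1, ha⟩ : ∃ a : ℝ≥0, 0 < a ∧ a ≤ 1 ∧
      (a : ℝ≥0∞) * (complementary φ.toFun u * μ A) ≤ 1 := by
    have hfin : complementary φ.toFun u * μ A ≠ ∞ := ENNReal.mul_ne_top hut hAt.ne
    lift complementary φ.toFun u * μ A to ℝ≥0 using hfin with K
    refine ⟨1 / (K + 1), by positivity, ?_, ?_⟩
    · exact div_le_one_of_le₀ (by simp) zero_le
    · rw [← ENNReal.coe_mul, ← ENNReal.coe_one, ENNReal.coe_le_coe, one_div_mul_eq_div]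
      exact div_le_one_of_le₀ (by simp) zero_le
  set s : ℝ≥0 := a * u with hs
  have hs0 : 0 < s := mul_pos ha0 hu
  let g₀ : Ω → ℝ := A.indicator fun t => (s : ℝ) * SignType.sign (toAEEqFun f t)
  have hg₀ : Measurable g₀ := by
    refine Measurable.indicator ?_ hA
    refine Measurable.const_mul ?_ _
    have hsg : Measurable fun x : ℝ => ((SignType.sign x : SignType) : ℝ) := by
      refine Monotone.measurable fun x y hxy => ?_
      have h2 := SignType.sign.monotone hxy
      revert h2
      generalize SignType.sign x = p
      generalize SignType.sign y = q
      cases p <;> cases q <;> simp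
    exact hsg.comp (toAEEqFun f).measurable
  let g : Ω →ₘ[μ] ℝ := AEEqFun.mk g₀ hg₀.aestronglyMeasurable
  have hgg : g =ᵐ[μ] g₀ := AEEqFun.coeFn_mk _ _
  have hg : modular (complementary φ.toFun) μ g ≤ 1 := by
    have h1 : modular (complementary φ.toFun) μ g ≤ ∫⁻ t, A.indicator (fun _ => complementary φ.toFun s) t ∂μ := by
      refine lintegral_mono_ae ?_
      filter_upwards [hgg] with t ht
      rw [ht]
      by_cases htA : t ∈ A
      · have h0 : toAEEqFun f t ≠ 0 := hAS htA
        simp only [g₀, indicator_of_mem htA]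
        refine le_of_eq (congrArg _ ?_)
        rw [← NNReal.coe_inj]
        rcases lt_or_gt_of_ne h0 with h | h <;> simp [sign_neg, sign_pos, h]
      · simp [g₀, indicator_of_notMem htA, φ.compl_zero]
    refine h1.trans ?_
    rw [lintegral_indicator_const hA]
    refine le_trans ?_ ha
    rw [← mul_assoc]
    gcongr
    exact φ.compl_mul_le a u ha1
  have hle := integral_le_norm f hg
  rw [h] at hle
  have hnn : 0 ≤ᵐ[μ] fun t => toAEEqFun f t * g t := by
    filter_upwards [hgg] with t ht
    rw [ht]
    by_cases htA : t ∈ A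
    · simp only [g₀, indicator_of_mem htA, Pi.zero_apply]
      rw [mul_left_comm, self_mul_sign]
      positivity
    · simp [g₀, indicator_of_notMem htA]
  have h0 := (integral_eq_zero_iff_of_nonneg_ae hnn (integrable_mul f hg)).mp
    (le_antisymm hle (integral_nonneg_of_ae hnn))
  have hAz : μ A = 0 := by
    rw [measure_eq_zero_iff_ae_notMem]
    filter_upwards [hgg, h0] with t ht ht0 htA
    have hne : toAEEqFun f t ≠ 0 := hAS htA
    rw [ht] at ht0
    simp only [g₀, indicator_of_mem htA, Pi.zero_apply] at ht0
    rw [mul_left_comm, self_mul_sign] at ht0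
    have : 0 < (s : ℝ) * |toAEEqFun f t| := mul_pos (by exact_mod_cast hs0) (abs_pos.mpr hne)
    exact this.ne' ht0
  exact hA0.ne' hAz

theorem normCore [SigmaFinite μ] : NormedSpace.Core ℝ (φ.OrliczSpace μ) where
  norm_nonneg := norm_nonneg'
  norm_smul c f := by
    refine le_antisymm (norm_smul_le' c f) ?_
    rcases eq_or_ne c 0 with rfl | hc
    · simpa using norm_nonneg' _
    · have h := norm_smul_le' c⁻¹ (c • f)
      rw [smul_smul, inv_mul_cancel₀ hc, one_smul, abs_inv] at h
      have hp : 0 < |c| := abs_pos.mpr hc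
      rw [inv_mul_eq_div, le_div_iff₀ hp] at h
      rw [Real.norm_eq_abs]
      linarith
  norm_triangle := norm_add_le'
  norm_eq_zero_iff f := by
    refine ⟨eq_zero_of_norm_eq_zero f, ?_⟩
    rintro rfl
    have h := norm_smul_le' (0 : ℝ) (0 : φ.OrliczSpace μ)
    rw [smul_zero, abs_zero, zero_mul] at h
    exact le_antisymm h (norm_nonneg' _)

instance instNormedAddCommGroup [SigmaFinite μ] : NormedAddCommGroup (φ.OrliczSpace μ) :=
  NormedAddCommGroup.ofCore normCore

instance instNormedSpace [SigmaFinite μ] : NormedSpace ℝ (φ.OrliczSpace μ) :=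
  NormedSpace.ofCore normCore

end OrliczSpace

end OrliczFunction

/-- The slice `{x ∈ B_X : x*(x) > 1 - ε}` of the closed unit ball. -/
def unitBallSlice {X : Type*} [NormedAddCommGroup X] [NormedSpace ℝ X]
    (x' : StrongDual ℝ X) (ε : ℝ) : Set X :=
  {x | ‖x‖ ≤ 1 ∧ 1 - ε < x' x}

/-- The local diameter two property: every slice of the unit ball, given by a functional of
norm one and an `ε > 0`, has diameter two. -/
def LocalDiameterTwoProperty (X : Type*) [NormedAddCommGroup X] [NormedSpace ℝ X] : Prop :=
  ∀ x' : StrongDual ℝ X, ‖x'‖ = 1 → ∀ ε : ℝ, 0 < ε → Metric.diam (unitBallSlice x' ε) = 2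

end

/-! The functional exhibiting a slice of small diameter is integration against `g = c · 1_A`, where
`φ_*(c) μ(A) = 1`. Jensen's inequality shows that `1_A` attains its norm at `g`, so this functional
has norm one.

Suppose some `θ > 1/2` is such that, for every `h` in the unit ball of the modular of `φ_*`, one of
`θ(g ± h)` stays in that ball. If `f`, `f'` lie in the slice, then `∫ f g` and `∫ f' g` are nearly
1, so either `∫ f h` or `-∫ f' h` is at most about `1/θ - 1`, the other being at most 1. Hence `‖f -
f'‖` is at most about `1/θ < 2` (`not_localDiameterTwoProperty`).

The factor `θ` comes from convexity. For `c` beyond `d_{φ_*}` the midpoint lies strictly below the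
chord, `2 φ_*(c/2) < φ_*(c)` (`compl_half_lt`), and this gap survives a slight dilation past `1/2`.
In the nonatomic case `c < b_{φ_*}` leaves a finite value to the right of `c`. A pointwise estimate
(`exists_compl_sum_le`) then integrates to show that the modulars of `θ(g + h)` and `θ(g - h)` sum
to at most 2; Sierpiński's theorem supplies `A`. In the sequence case `A` is one point and `c =
c_{φ_*}`, so the sign can be chosen to keep that coordinate of `g ± h` within `c`. -/

namespace OrliczFunction

open Orlicz

variable {Ω : Type*} [MeasurableSpace Ω] {μ : Measure Ω} {φ : OrliczFunction}

/-! ### Convexity, strict growth and semicontinuity of complementary functions. -/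

theorem compl_mono (φ : OrliczFunction) : Monotone (complementary φ.toFun) := fun u v huv =>
  iSup_mono fun w => by gcongr

/-- A complementary function is convex. -/
theorem compl_convex (φ : OrliczFunction) {a b : ℝ≥0} (hab : a + b = 1) (u v : ℝ≥0) :
    complementary φ.toFun (a * u + b * v) ≤
      a * complementary φ.toFun u + b * complementary φ.toFun v := by
  refine iSup_le fun w => ?_
  rw [tsub_le_iff_left]
  have hu := φ.young w u
  have hv := φ.young w v
  calc ((a * u + b * v : ℝ≥0) : ℝ≥0∞) * (w : ℝ≥0∞)
      = a * ((w * u : ℝ≥0) : ℝ≥0∞) + b * ((w * v : ℝ≥0) : ℝ≥0∞) := by push_cast; ring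
    _ ≤ a * (φ.toFun w + complementary φ.toFun u) + b * (φ.toFun w + complementary φ.toFun v) := by
        gcongr
    _ = ((a + b : ℝ≥0) : ℝ≥0∞) * φ.toFun w +
        (a * complementary φ.toFun u + b * complementary φ.toFun v) := by push_cast; ring
    _ = _ := by rw [hab, ENNReal.coe_one, one_mul]

/-- Beyond the linearity bound, a complementary function lies strictly below its chord at the
midpoint. -/
theorem compl_half_lt (φ : OrliczFunction) {c : ℝ≥0} (hd : linearBound (complementary φ.toFun) < c)
    (h0 : complementary φ.toFun c ≠ 0) (htop : complementary φ.toFun c ≠ ∞) :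
    2 * complementary φ.toFun (c / 2) < complementary φ.toFun c := by
  -- If the midpoint is not below the chord, convexity makes `φ_*` linear on `[0, c]` with slope
  -- `φ_*(c)/c > 0`, so `c` enters the supremum defining the linearity bound.
  by_contra! hle
  have hc : 0 < c := pos_iff_ne_zero.mpr fun h => h0 (h ▸ φ.compl_zero)
  have hfin : ∀ v, v ≤ c → complementary φ.toFun v ≠ ∞ := fun v hv =>
    ne_top_of_le_ne_top htop (φ.compl_mono hv)
  refine hd.not_ge (le_sSup ⟨c, rfl, (complementary φ.toFun c).toNNReal / c,
    div_pos (ENNReal.toNNReal_pos h0 htop) hc, fun v hv => ?_⟩)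
  have hup := φ.compl_mul_le (v / c) c (div_le_one_of_le₀ hv zero_le)
  rw [div_mul_cancel₀ _ hc.ne'] at hup
  rcases hv.eq_or_lt with rfl | hvc
  · rw [← ENNReal.coe_mul, div_mul_cancel₀ _ hc.ne', ENNReal.coe_toNNReal htop]
  rcases eq_or_ne v 0 with rfl | hv0
  · simp [φ.compl_zero]
  have hv0' : 0 < v := pos_iff_ne_zero.mpr hv0
  have hC := ENNReal.coe_toNNReal htop
  have hV := ENNReal.coe_toNNReal (hfin v hv)
  have hM := ENNReal.coe_toNNReal (hfin (c / 2) (half_le_self zero_le))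
  have hmid : v ≤ c / 2 → ∃ a b : ℝ≥0, a + b = 1 ∧ a * v + b * c = c / 2 := by
    intro h
    refine ⟨(c / 2) / (c - v), (c / 2 - v) / (c - v), ?_, ?_⟩ <;>
    · rw [← NNReal.coe_inj]
      have : (v : ℝ) < c := by exact_mod_cast hvc
      have h' : (c : ℝ) - v ≠ 0 := by linarith
      push_cast [NNReal.coe_sub hv, NNReal.coe_sub h]
      field_simp
      ring
  -- The chord is also a lower bound: a value below it at `v` would drag the midpoint below it. For
  -- `v ≤ c/2` the midpoint lies between `v` and `c`, otherwise between `0` and `v`.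
  have hlow : v * (complementary φ.toFun c).toNNReal ≤ c * (complementary φ.toFun v).toNNReal := by
    generalize hCd : (complementary φ.toFun c).toNNReal = C at *
    generalize hVd : (complementary φ.toFun v).toNNReal = V at *
    generalize hMd : (complementary φ.toFun (c / 2)).toNNReal = M at *
    rw [← hC, ← hM] at hle
    have hle' : (C : ℝ) ≤ 2 * M := by exact_mod_cast hle
    rw [← NNReal.coe_le_coe]
    push_cast
    rcases le_total v (c / 2) with h | h
    · obtain ⟨a, b, hab, habv⟩ := hmid h
      have h1 := φ.compl_convex hab v c
      rw [habv, ← hM, ← hV, ← hC] at h1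
      have h2 : (M : ℝ) ≤ a * V + b * C := by exact_mod_cast h1
      have hab' : (a : ℝ) + b = 1 := by exact_mod_cast hab
      have habv' : (a : ℝ) * v + b * c = c / 2 := by
        rw [← NNReal.coe_inj] at habv; push_cast at habv; exact habv
      have ha : 0 < (a : ℝ) := by
        rcases a.2.eq_or_lt with ha | ha
        · have : (a : ℝ) = 0 := ha.symm
          have hc' : (0 : ℝ) < c := by exact_mod_cast hc
          nlinarith
        · exact ha
      refine le_of_mul_le_mul_left ?_ ha
      have hc' : (0 : ℝ) < c := by exact_mod_cast hc
      have h3 : (c : ℝ) / 2 * C ≤ c * (a * V + b * C) := by nlinarith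
      have h4 : (c : ℝ) / 2 * C = (a * v + b * c) * C := by rw [habv']
      linarith
    · have h1 := φ.compl_mul_le (c / 2 / v) v (div_le_one_of_le₀ h zero_le)
      rw [div_mul_cancel₀ _ hv0, ← hM, ← hV] at h1
      have h2 : (M : ℝ) ≤ c / 2 / v * V := by
        rw [← ENNReal.coe_mul, ENNReal.coe_le_coe, ← NNReal.coe_le_coe] at h1
        push_cast at h1; exact h1
      have hv' : (0 : ℝ) < v := by exact_mod_cast hv0'
      have h3 : (v : ℝ) * M ≤ c / 2 * V := by
        calc (v : ℝ) * M ≤ v * (c / 2 / v * V) := by gcongr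
          _ = _ := by field_simp
      nlinarith
  refine le_antisymm ?_ ?_
  · refine hup.trans_eq ?_
    nth_rw 1 [← hC]
    rw [← ENNReal.coe_mul, ← ENNReal.coe_mul, div_mul_eq_mul_div, div_mul_eq_mul_div, mul_comm v]
  · rw [← hV, ← ENNReal.coe_mul, ENNReal.coe_le_coe, div_mul_eq_mul_div, div_le_iff₀ hc]
    rw [mul_comm, mul_comm _ c]
    exact hlow

/-- A complementary function is strictly monotone where it is positive and finite. -/
theorem le_of_compl_le (φ : OrliczFunction) {c u : ℝ≥0} (h0 : complementary φ.toFun c ≠ 0)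
    (htop : complementary φ.toFun c ≠ ∞)
    (h : complementary φ.toFun u ≤ complementary φ.toFun c) : u ≤ c := by
  by_contra! hcu
  have hu : 0 < u := zero_le.trans_lt hcu
  -- As `c = (c/u) u` with `c/u < 1`, convexity gives `φ_*(c) ≤ (c/u) φ_*(c)`, impossible for a
  -- positive finite value.
  have h1 := φ.compl_mul_le (c / u) u (div_le_one_of_le₀ hcu.le zero_le)
  rw [div_mul_cancel₀ _ hu.ne'] at h1
  have h2 : complementary φ.toFun c ≤ ((c / u : ℝ≥0) : ℝ≥0∞) * complementary φ.toFun c :=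
    h1.trans (by gcongr)
  have h3 : ((c / u : ℝ≥0) : ℝ≥0∞) < 1 := by
    exact_mod_cast (div_lt_one hu).mpr hcu
  have h4 := ENNReal.mul_lt_mul_left h0 htop h3
  rw [one_mul] at h4
  exact h4.not_ge h2

/-- Lower semicontinuity of a complementary function, from the left. -/
theorem exists_lt_compl (φ : OrliczFunction) {b : ℝ≥0} {r : ℝ≥0∞}
    (h : r < complementary φ.toFun b) : ∃ u < b, r < complementary φ.toFun u := by
  -- A single term of the supremum already exceeds `r` at `b`, and it is continuous in `u`.
  obtain ⟨v, hv⟩ := lt_iSup_iff.mp h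
  have hb : 0 < b := by
    rcases eq_or_ne b 0 with rfl | h
    · simp at hv
    · exact pos_iff_ne_zero.mpr h
  have hcont : Filter.Tendsto (fun u : ℝ≥0 => ((u : ℝ≥0∞) * (v : ℝ≥0∞) - φ.toFun v))
      (𝓝[<] b) (𝓝 ((b : ℝ≥0∞) * (v : ℝ≥0∞) - φ.toFun v)) := by
    refine Filter.Tendsto.mono_left ?_ nhdsWithin_le_nhds
    have h1 : Filter.Tendsto (fun u : ℝ≥0 => (u : ℝ≥0∞) * (v : ℝ≥0∞)) (𝓝 b)
        (𝓝 ((b : ℝ≥0∞) * (v : ℝ≥0∞))) :=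
      ENNReal.Tendsto.mul_const (ENNReal.tendsto_coe.mpr Filter.tendsto_id)
        (Or.inr ENNReal.coe_ne_top)
    exact ENNReal.Tendsto.sub h1 tendsto_const_nhds
      (Or.inl (ENNReal.mul_ne_top ENNReal.coe_ne_top ENNReal.coe_ne_top))
  have hne : (𝓝[<] b).NeBot := nhdsLT_neBot_of_exists_lt ⟨0, hb⟩
  obtain ⟨u, hu1, hu2⟩ := ((hcont.eventually (lt_mem_nhds hv)).and self_mem_nhdsWithin).exists
  exact ⟨u, hu2, hu1.trans_le (le_iSup (fun v : ℝ≥0 => (u : ℝ≥0∞) * (v : ℝ≥0∞) - φ.toFun v) v)⟩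

/-- Complementary functions are unbounded. -/
theorem iSup_compl (φ : OrliczFunction) : ⨆ u, complementary φ.toFun u = ∞ := by
  obtain ⟨v, hv, hφ⟩ := φ.exists_ne_top'
  refine ENNReal.eq_top_of_forall_nnreal_le fun r => ?_
  refine le_iSup_of_le ((r + (φ.toFun v).toNNReal) / v) ?_
  refine le_iSup_of_le v ?_
  rw [← ENNReal.coe_mul, div_mul_cancel₀ _ hv.ne', ENNReal.coe_add, ENNReal.coe_toNNReal hφ,
    ENNReal.add_sub_cancel_right hφ]

end OrliczFunction

/-! ### Intermediate values of nonatomic measures. -/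

namespace Orlicz

variable {Ω : Type*} [MeasurableSpace Ω] {μ : Measure Ω}

/-- A nonatomic measure has subsets of arbitrarily small positive measure. -/
theorem IsNonatomic.exists_small (hμ : IsNonatomic μ) {A : Set Ω} (hA : MeasurableSet A)
    (h0 : 0 < μ A) (htop : μ A ≠ ∞) {ε : ℝ≥0∞} (hε : 0 < ε) :
    ∃ B, MeasurableSet B ∧ B ⊆ A ∧ 0 < μ B ∧ μ B ≤ ε := by
  -- Splitting a set into two parts of positive measure, the smaller part has at most half the
  -- measure; iterate.
  have step : ∀ n : ℕ, ∃ B, MeasurableSet B ∧ B ⊆ A ∧ 0 < μ B ∧ μ B ≤ (2⁻¹ : ℝ≥0∞) ^ n * μ A := by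
    intro n
    induction n with
    | zero => exact ⟨A, hA, Subset.rfl, h0, by simp⟩
    | succ n ih =>
      obtain ⟨B, hB, hBA, hB0, hBn⟩ := ih
      obtain ⟨C, hC, hCB, hC0, hCB'⟩ := hμ B hB hB0
      have hle : ∀ x : ℝ≥0∞, x ≤ 2⁻¹ * μ B → x ≤ (2⁻¹ : ℝ≥0∞) ^ (n + 1) * μ A := fun x hx => by
        refine hx.trans ?_
        rw [pow_succ', mul_assoc]
        gcongr
      have hadd : μ C + μ (B \ C) = μ B := by
        rw [← measure_inter_add_sdiff B hC, inter_eq_self_of_subset_right hCB]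
      rcases le_total (μ C) (2⁻¹ * μ B) with h | h
      · exact ⟨C, hC, hCB.trans hBA, hC0, hle _ h⟩
      · refine ⟨B \ C, hB.diff hC, sdiff_subset.trans hBA, ?_, hle _ ?_⟩
        · rw [pos_iff_ne_zero]
          intro h'
          rw [h', add_zero] at hadd
          exact hCB'.ne hadd
        · have hBfin : μ B ≠ ∞ := measure_ne_top_of_subset hBA htop
          have hh : μ B = 2⁻¹ * μ B + 2⁻¹ * μ B := by
            rw [← add_mul, ENNReal.inv_two_add_inv_two, one_mul]
          have h1 : 2⁻¹ * μ B + μ (B \ C) ≤ 2⁻¹ * μ B + 2⁻¹ * μ B := by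
            rw [← hh, ← hadd]
            gcongr
            rw [hadd]
            exact h
          exact (ENNReal.add_le_add_iff_left (ENNReal.mul_ne_top (by simp) hBfin)).mp h1
  have hlim : Filter.Tendsto (fun n : ℕ => (2⁻¹ : ℝ≥0∞) ^ n * μ A) Filter.atTop (𝓝 (0 * μ A)) :=
    ENNReal.Tendsto.mul_const (ENNReal.tendsto_pow_atTop_nhds_zero_of_lt_one (by simp))
      (Or.inr htop)
  rw [zero_mul] at hlim
  obtain ⟨n, hn⟩ := (hlim.eventually (gt_mem_nhds hε)).exists
  obtain ⟨B, hB, hBA, hB0, hBn⟩ := step n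
  exact ⟨B, hB, hBA, hB0, hBn.trans hn.le⟩

/-- Sierpiński's theorem: a nonatomic measure takes all intermediate values. -/
theorem IsNonatomic.exists_subset_measure_eq (hμ : IsNonatomic μ) {A : Set Ω}
    (hA : MeasurableSet A) (htop : μ A ≠ ∞) {t : ℝ≥0∞} (ht : t ≤ μ A) :
    ∃ B, MeasurableSet B ∧ B ⊆ A ∧ μ B = t := by
  -- Greedy exhaustion: `P B C` says that `C` may be adjoined to `B` without exceeding `t`, `σ B` is
  -- the supremum of the possible gains, and each stage realises at least half of it.
  let P : Set Ω → Set Ω → Prop := fun B C =>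
    MeasurableSet C ∧ C ⊆ A \ B ∧ μ (B ∪ C) ≤ t
  let σ : Set Ω → ℝ≥0∞ := fun B => ⨆ C : {C // P B C}, μ C.1
  have htt : t ≠ ∞ := ne_top_of_le_ne_top htop ht
  have hσ : ∀ B, σ B ≠ ∞ := fun B => by
    refine ne_top_of_le_ne_top htt (iSup_le fun C => ?_)
    exact (measure_mono subset_union_right).trans C.2.2.2
  have hchoose : ∀ B : {B // MeasurableSet B ∧ B ⊆ A ∧ μ B ≤ t},
      ∃ C, P B.1 C ∧ σ B.1 ≤ 2 * μ C := by
    intro B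
    by_cases h0 : σ B.1 = 0
    · exact ⟨∅, ⟨MeasurableSet.empty, empty_subset _, by simpa using B.2.2.2⟩, by simp [h0]⟩
    · have hlt : σ B.1 / 2 < σ B.1 := ENNReal.half_lt_self h0 (hσ _)
      obtain ⟨C, hC⟩ := lt_iSup_iff.mp hlt
      refine ⟨C.1, C.2, ?_⟩
      rw [mul_comm, ← ENNReal.div_le_iff_le_mul (by simp) (by simp)]
      exact hC.le
  choose C hCP hCσ using hchoose
  let next : {B // MeasurableSet B ∧ B ⊆ A ∧ μ B ≤ t} → {B // MeasurableSet B ∧ B ⊆ A ∧ μ B ≤ t} :=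
    fun B => ⟨B.1 ∪ C B, B.2.1.union (hCP B).1,
      union_subset B.2.2.1 ((hCP B).2.1.trans sdiff_subset), (hCP B).2.2⟩
  let B : ℕ → {B // MeasurableSet B ∧ B ⊆ A ∧ μ B ≤ t} := fun n =>
    next^[n] ⟨∅, MeasurableSet.empty, empty_subset _, by simp⟩
  have hBs : ∀ n, B (n + 1) = next (B n) := fun n => Function.iterate_succ_apply' _ _ _
  have hmono : Monotone fun n => (B n).1 := monotone_nat_of_le_succ fun n => by
    change (B n).1 ⊆ (B (n + 1)).1
    rw [hBs]
    exact subset_union_left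
  have hUm : MeasurableSet (⋃ n, (B n).1) := MeasurableSet.iUnion fun n => (B n).2.1
  have hUA : (⋃ n, (B n).1) ⊆ A := iUnion_subset fun n => (B n).2.2.1
  have hUt : μ (⋃ n, (B n).1) ≤ t := by
    rw [hmono.measure_iUnion]
    exact iSup_le fun n => (B n).2.2.2
  refine ⟨_, hUm, hUA, hUt.antisymm ?_⟩
  -- If the union falls short of `t`, a set `D` of positive measure fits into the remaining gap and
  -- is therefore admissible at every stage. Each stage then gains at least `μ D / 2`, which cannot
  -- go on below `t`.
  by_contra! hlt
  have hpos : 0 < μ (A \ ⋃ n, (B n).1) := by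
    rw [measure_sdiff hUA hUm.nullMeasurableSet (ne_top_of_le_ne_top htt hUt)]
    exact tsub_pos_of_lt (hlt.trans_le ht)
  obtain ⟨D, hD, hDA, hD0, hDε⟩ := hμ.exists_small (hA.diff hUm) hpos
    (measure_ne_top_of_subset sdiff_subset htop) (tsub_pos_of_lt hlt)
  have hDσ : ∀ n, μ D ≤ σ (B n).1 := fun n => by
    have hsub : (B n).1 ⊆ ⋃ n, (B n).1 := subset_iUnion (fun n => (B n).1) n
    refine le_iSup (fun C : {C // P (B n).1 C} => μ C.1)
      ⟨D, hD, hDA.trans (sdiff_subset_sdiff_right hsub), ?_⟩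
    calc μ ((B n).1 ∪ D) ≤ μ (⋃ n, (B n).1) + (t - μ (⋃ n, (B n).1)) :=
          (measure_union_le _ _).trans (add_le_add (measure_mono hsub) hDε)
      _ = t := add_tsub_cancel_of_le hUt
  have hgrow : ∀ n : ℕ, n * μ D ≤ 2 * μ (B n).1 := by
    intro n
    induction n with
    | zero => simp
    | succ n ih =>
      rw [hBs]
      change _ ≤ 2 * μ ((B n).1 ∪ C (B n))
      rw [measure_union (disjoint_sdiff_right.mono_right (hCP (B n)).2.1) (hCP (B n)).1, mul_add]
      push_cast
      rw [add_mul, one_mul]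
      exact add_le_add ih ((hDσ n).trans (hCσ _))
  have hbound : ∀ n : ℕ, (n : ℝ≥0∞) * μ D ≤ 2 * t := fun n =>
    (hgrow n).trans (by gcongr; exact (B n).2.2.2)
  obtain ⟨n, hn⟩ := ENNReal.exists_nat_mul_gt hD0.ne' (ENNReal.mul_ne_top (ENNReal.ofNat_ne_top (n := 2)) htt)
  exact hn.not_ge (hbound n)

end Orlicz

/-! ### Integral functionals and a dual criterion for slices of diameter below two. -/

namespace OrliczFunction

open Orlicz

variable {Ω : Type*} [MeasurableSpace Ω] {μ : Measure Ω} {φ : OrliczFunction}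

namespace OrliczSpace

theorem integral_neg_le_norm (f : φ.OrliczSpace μ) {g : Ω →ₘ[μ] ℝ}
    (hg : modular (complementary φ.toFun) μ g ≤ 1) : -∫ t, toAEEqFun f t * g t ∂μ ≤ ‖f‖ := by
  have hn : modular (complementary φ.toFun) μ (-g : Ω →ₘ[μ] ℝ) ≤ 1 := by
    rw [modular_congr (g := g)]
    · exact hg
    · filter_upwards [AEEqFun.coeFn_neg g] with t ht
      rw [ht, Pi.neg_apply, nnnorm_neg]
  refine le_trans (le_of_eq ?_) (integral_le_norm f hn)
  rw [← integral_neg]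
  refine integral_congr_ae ?_
  filter_upwards [AEEqFun.coeFn_neg g] with t ht
  rw [ht, Pi.neg_apply, mul_neg]

theorem integral_add_mul (f f' : φ.OrliczSpace μ) {g : Ω →ₘ[μ] ℝ}
    (hg : modular (complementary φ.toFun) μ g ≤ 1) :
    ∫ t, toAEEqFun (f + f') t * g t ∂μ =
      ∫ t, toAEEqFun f t * g t ∂μ + ∫ t, toAEEqFun f' t * g t ∂μ := by
  rw [← integral_add (integrable_mul f hg) (integrable_mul f' hg)]
  refine integral_congr_ae ?_
  rw [map_add]
  filter_upwards [AEEqFun.coeFn_add (toAEEqFun f) (toAEEqFun f')] with t ht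
  rw [ht, Pi.add_apply, add_mul]

theorem integral_smul_mul (c : ℝ) (f : φ.OrliczSpace μ) (g : Ω →ₘ[μ] ℝ) :
    ∫ t, toAEEqFun (c • f) t * g t ∂μ = c * ∫ t, toAEEqFun f t * g t ∂μ := by
  rw [← integral_const_mul]
  refine integral_congr_ae ?_
  rw [map_smul]
  filter_upwards [AEEqFun.coeFn_smul c (toAEEqFun f)] with t ht
  rw [ht, Pi.smul_apply, smul_eq_mul, mul_assoc]

/-- The functional on the Orlicz space given by an element of the unit ball of the dual space. -/
noncomputable def integralFunctional [SigmaFinite μ] (g : Ω →ₘ[μ] ℝ)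
    (hg : modular (complementary φ.toFun) μ g ≤ 1) : StrongDual ℝ (φ.OrliczSpace μ) :=
  LinearMap.mkContinuous
    { toFun := fun f => ∫ t, toAEEqFun f t * g t ∂μ
      map_add' := fun f f' => integral_add_mul f f' hg
      map_smul' := fun c f => integral_smul_mul c f g } 1 fun f => by
    rw [one_mul, Real.norm_eq_abs, abs_le']
    exact ⟨integral_le_norm f hg, integral_neg_le_norm f hg⟩

theorem integralFunctional_apply [SigmaFinite μ] (g : Ω →ₘ[μ] ℝ)
    (hg : modular (complementary φ.toFun) μ g ≤ 1) (f : φ.OrliczSpace μ) :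
    integralFunctional g hg f = ∫ t, toAEEqFun f t * g t ∂μ := rfl

/-- The bound by one is built into the functional; equality holds because it is attained in the
direction of `f`. -/
theorem norm_integralFunctional [SigmaFinite μ] (g : Ω →ₘ[μ] ℝ)
    (hg : modular (complementary φ.toFun) μ g ≤ 1) (f : φ.OrliczSpace μ) (hf : f ≠ 0)
    (hfg : ‖f‖ ≤ ∫ t, toAEEqFun f t * g t ∂μ) : ‖integralFunctional (φ := φ) g hg‖ = 1 := by
  refine le_antisymm (LinearMap.mkContinuous_norm_le _ zero_le_one _) ?_
  have hpos : 0 < ‖f‖ := norm_pos_iff.mpr hf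
  have h1 := (integralFunctional (φ := φ) g hg).le_opNorm f
  rw [integralFunctional_apply, Real.norm_eq_abs] at h1
  have h2 := le_abs_self (∫ t, toAEEqFun f t * g t ∂μ)
  refine le_of_mul_le_mul_right ?_ hpos
  linarith

/-- Pairing with `θ (g + s h)`, where `s = ±1`. -/
theorem integral_mul_comb (f : φ.OrliczSpace μ) {g h : Ω →ₘ[μ] ℝ}
    (hg : modular (complementary φ.toFun) μ g ≤ 1) (hh : modular (complementary φ.toFun) μ h ≤ 1)
    {θ s : ℝ} (hgh : modular (complementary φ.toFun) μ (fun t => θ * (g t + s * h t)) ≤ 1) :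
    θ * (∫ t, toAEEqFun f t * g t ∂μ + s * ∫ t, toAEEqFun f t * h t ∂μ) ≤ ‖f‖ := by
  have ha : ((θ • (g + s • h) : Ω →ₘ[μ] ℝ) : Ω → ℝ) =ᵐ[μ] fun t => θ * (g t + s * h t) := by
    filter_upwards [AEEqFun.coeFn_smul θ (g + s • h), AEEqFun.coeFn_add g (s • h),
      AEEqFun.coeFn_smul s h] with t h1 h2 h3
    rw [h1, Pi.smul_apply, h2, Pi.add_apply, h3, Pi.smul_apply, smul_eq_mul, smul_eq_mul]
  have hm : modular (complementary φ.toFun) μ (θ • (g + s • h) : Ω →ₘ[μ] ℝ) ≤ 1 := by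
    rw [modular_congr (ha.mono fun t ht => by rw [ht])]
    exact hgh
  refine le_trans (le_of_eq ?_) (integral_le_norm f hm)
  rw [← integral_const_mul s, ← integral_add (integrable_mul f hg)
    ((integrable_mul f hh).const_mul s), ← integral_const_mul]
  refine integral_congr_ae ?_
  filter_upwards [ha] with t ht
  rw [ht]
  ring

/-- If the unit ball of the dual modular has a norming element which is uniformly nonsquare, then
the Orlicz space fails the local diameter two property. -/
theorem not_localDiameterTwoProperty [SigmaFinite μ] (g : Ω →ₘ[μ] ℝ)
    (hg : modular (complementary φ.toFun) μ g ≤ 1) (f₀ : φ.OrliczSpace μ) (hf₀ : f₀ ≠ 0)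
    (hfg : ‖f₀‖ ≤ ∫ t, toAEEqFun f₀ t * g t ∂μ) {θ : ℝ} (hθ : 1 / 2 < θ)
    (H : ∀ h : Ω →ₘ[μ] ℝ, modular (complementary φ.toFun) μ h ≤ 1 →
      modular (complementary φ.toFun) μ (fun t => θ * (g t + 1 * h t)) ≤ 1 ∨
      modular (complementary φ.toFun) μ (fun t => θ * (g t + (-1) * h t)) ≤ 1) :
    ¬ LocalDiameterTwoProperty (φ.OrliczSpace μ) := by
  intro hL
  have hθ0 : 0 < θ := by linarith
  have hθ2 : 1 / θ < 2 := by
    rw [div_lt_iff₀ hθ0]; linarith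
  have hθpos : 0 < 1 / θ := by positivity
  -- Here `ε` is half the gap `2 - 1/θ`, so that `1/θ + ε` is still below 2.
  have key := hL (integralFunctional g hg) (norm_integralFunctional g hg f₀ hf₀ hfg)
    ((2 - 1 / θ) / 2) (by linarith)
  have hle : Metric.diam (unitBallSlice (integralFunctional (φ := φ) g hg) ((2 - 1 / θ) / 2)) ≤
      1 / θ + (2 - 1 / θ) / 2 := by
    refine Metric.diam_le_of_forall_dist_le (by linarith) ?_
    rintro f ⟨hf1, hf⟩ f' ⟨hf'1, hf'⟩
    rw [integralFunctional_apply] at hf hf'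
    rw [dist_eq_norm]
    refine norm_le_of _ fun h hh => ?_
    have e : ∫ t, toAEEqFun (f - f') t * h t ∂μ =
        ∫ t, toAEEqFun f t * h t ∂μ - ∫ t, toAEEqFun f' t * h t ∂μ := by
      rw [show f - f' = f + (-1 : ℝ) • f' by rw [neg_one_smul, sub_eq_add_neg],
        integral_add_mul _ _ hh, integral_smul_mul]
      ring
    rw [e]
    -- If `θ(g + h)` is in the ball, then `∫ f h ≤ 1/θ - ∫ f g < 1/θ - 1 + ε`, while `-∫ f' h ≤ 1`.
    -- The other sign exchanges the roles of `f` and `f'`.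
    rcases H h hh with h1 | h1
    · have h2 := (integral_mul_comb f hg hh h1).trans hf1
      have h3 := (integral_neg_le_norm f' hh).trans hf'1
      rw [mul_comm, ← le_div_iff₀ hθ0] at h2
      linarith
    · have h2 := (integral_mul_comb f' hg hh h1).trans hf'1
      have h3 := (integral_le_norm f hh).trans hf1
      rw [mul_comm, ← le_div_iff₀ hθ0] at h2
      linarith
  rw [key] at hle
  linarith

/-- Finiteness of `φ` at one positive point, used as the scaling factor, suffices because `μ A` is
finite. -/
theorem exists_coe_eq_indicator (φ : OrliczFunction) {A : Set Ω} (hA : MeasurableSet A)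
    (htop : μ A ≠ ∞) :
    ∃ f : φ.OrliczSpace μ, toAEEqFun f =ᵐ[μ] A.indicator fun _ => (1 : ℝ) := by
  have hm : Measurable (A.indicator fun _ => (1 : ℝ)) := measurable_const.indicator hA
  have hae := AEEqFun.coeFn_mk (μ := μ) _ hm.aestronglyMeasurable
  obtain ⟨u, hu, hφ⟩ := φ.exists_ne_top'
  refine ⟨⟨AEEqFun.mk _ hm.aestronglyMeasurable, u, by exact_mod_cast hu, ?_⟩, hae⟩
  have h1 : modular φ.toFun μ
      (fun t => (u : ℝ) * (AEEqFun.mk _ hm.aestronglyMeasurable : Ω →ₘ[μ] ℝ) t) ≤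
      ∫⁻ t, A.indicator (fun _ => φ.toFun u) t ∂μ := by
    refine lintegral_mono_ae ?_
    filter_upwards [hae] with t ht
    rw [ht]
    by_cases htA : t ∈ A
    · simp [htA]
    · simp [htA, φ.map_zero']
  refine h1.trans_lt ?_
  rw [lintegral_indicator_const hA]
  exact (ENNReal.mul_ne_top hφ htop).lt_top

end OrliczSpace

end OrliczFunction

/-! ### Dilated convexity estimates with a factor above one half. -/

namespace OrliczFunction

open Orlicz

/-- Serves to write `θ (c + h)` as a convex combination of `h`, `c` and a point beyond `c`. -/
theorem compl_convex_three (φ : OrliczFunction) {a b c : ℝ≥0} (habc : a + b + c = 1)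
    (u v w : ℝ≥0) :
    complementary φ.toFun (a * u + b * v + c * w) ≤
      a * complementary φ.toFun u + b * complementary φ.toFun v + c * complementary φ.toFun w := by
  refine iSup_le fun x => ?_
  rw [tsub_le_iff_left]
  have hu := φ.young x u
  have hv := φ.young x v
  have hw := φ.young x w
  calc ((a * u + b * v + c * w : ℝ≥0) : ℝ≥0∞) * (x : ℝ≥0∞)
      = a * ((x * u : ℝ≥0) : ℝ≥0∞) + b * ((x * v : ℝ≥0) : ℝ≥0∞)
        + c * ((x * w : ℝ≥0) : ℝ≥0∞) := by push_cast; ring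
    _ ≤ a * (φ.toFun x + complementary φ.toFun u) + b * (φ.toFun x + complementary φ.toFun v)
        + c * (φ.toFun x + complementary φ.toFun w) := by gcongr
    _ = ((a + b + c : ℝ≥0) : ℝ≥0∞) * φ.toFun x +
        (a * complementary φ.toFun u + b * complementary φ.toFun v
          + c * complementary φ.toFun w) := by push_cast; ring
    _ = _ := by rw [habc, ENNReal.coe_one, one_mul]

/-- Dilating slightly past the midpoint keeps the gap below the chord. -/
theorem exists_compl_mul_add_le (φ : OrliczFunction) {c : ℝ≥0}
    (htop : complementary φ.toFun c ≠ ∞)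
    (hc : 2 * complementary φ.toFun (c / 2) < complementary φ.toFun c) :
    ∃ θ : ℝ≥0, 1 / 2 < θ ∧ θ ≤ 1 ∧
      complementary φ.toFun (θ * c) + θ * complementary φ.toFun c ≤ complementary φ.toFun c := by
  have hC := ENNReal.coe_toNNReal htop
  have hM := ENNReal.coe_toNNReal
    (ne_top_of_le_ne_top htop (φ.compl_mono (half_le_self (zero_le : 0 ≤ c))))
  generalize (complementary φ.toFun c).toNNReal = C at *
  generalize (complementary φ.toFun (c / 2)).toNNReal = M at *
  have hMC : (2 : ℝ) * M < C := by
    rw [← hC, ← hM] at hc; exact_mod_cast hc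
  -- With `θ = (1 + s)/2`, the point `θ c` lies between `c/2` and `c`. At `s = 0` the bound reads `M
  -- + C/2 < C`, so it persists for small `s > 0`.
  have hcont : Continuous fun s : ℝ => (1 - s) * M + s * C + (1 + s) / 2 * C := by fun_prop
  have hev : ∀ᶠ s : ℝ in 𝓝 0, (1 - s) * M + s * C + (1 + s) / 2 * C < C :=
    (hcont.tendsto 0).eventually (gt_mem_nhds (by norm_num; linarith))
  obtain ⟨s, ⟨hs1, hs2⟩, hs0⟩ := (hev.and
    (gt_mem_nhds (zero_lt_one' ℝ)) |>.filter_mono (nhdsWithin_le_nhds (s := Ioi 0))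
    |>.and self_mem_nhdsWithin).exists
  have hs0' : 0 < s := hs0
  lift s to ℝ≥0 using hs0'.le
  have hs2' : s ≤ 1 := by exact_mod_cast hs2.le
  have hs0'' : 0 < s := by exact_mod_cast hs0'
  have h1 := φ.compl_convex (tsub_add_cancel_of_le hs2') (c / 2) c
  have e : (1 - s) * (c / 2) + s * c = (1 + s) / 2 * c := by
    rw [← NNReal.coe_inj]
    push_cast [NNReal.coe_sub hs2']
    ring
  refine ⟨(1 + s) / 2, ?_, ?_, ?_⟩
  · gcongr
    exact lt_add_of_pos_right _ hs0''
  · rw [div_le_one two_pos, ← one_add_one_eq_two]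
    gcongr
  · rw [e, ← hC, ← hM] at h1
    rw [← hC]
    refine (add_le_add_left h1 _).trans ?_
    rw [← ENNReal.coe_mul, ← ENNReal.coe_mul, ← ENNReal.coe_mul, ← ENNReal.coe_add,
      ← ENNReal.coe_add, ENNReal.coe_le_coe, ← NNReal.coe_le_coe]
    push_cast [NNReal.coe_sub hs2']
    exact hs1.le

/-- The uniform nonsquareness estimate at a point which lies below its chord at the midpoint. -/
theorem exists_compl_sum_le (φ : OrliczFunction) {c e : ℝ≥0} (hce : c < e)
    (htop : complementary φ.toFun e ≠ ∞)
    (hc : 2 * complementary φ.toFun (c / 2) < complementary φ.toFun c) :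
    ∃ θ : ℝ≥0, 1 / 2 < θ ∧ θ ≤ 1 ∧ ∀ h : ℝ≥0,
      complementary φ.toFun (θ * (c + h)) + (complementary φ.toFun (θ * c)
        + complementary φ.toFun (θ * h)) ≤
      2 * θ * complementary φ.toFun h + ((2 - 2 * θ : ℝ≥0) : ℝ≥0∞) * complementary φ.toFun c := by
  have hctop := ne_top_of_le_ne_top htop (φ.compl_mono hce.le)
  have hC := ENNReal.coe_toNNReal hctop
  have hE := ENNReal.coe_toNNReal htop
  have hM := ENNReal.coe_toNNReal
    (ne_top_of_le_ne_top hctop (φ.compl_mono (half_le_self (zero_le : 0 ≤ c))))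
  generalize (complementary φ.toFun c).toNNReal = C at *
  generalize (complementary φ.toFun e).toNNReal = E at *
  generalize (complementary φ.toFun (c / 2)).toNNReal = M at *
  have hMC : (2 : ℝ) * M < C := by
    rw [← hC, ← hM] at hc; exact_mod_cast hc
  have hce' : (0 : ℝ) < e - c := sub_pos.mpr (by exact_mod_cast hce)
  -- Moving weight `s k` from `c` to `e` raises the combination by exactly `s c`, the excess of
  -- dilating by `(1 + s)/2` over `(1 - s)/2`.
  obtain ⟨k, hk⟩ : ∃ k : ℝ≥0, (k : ℝ) * (e - c) = c :=
    ⟨c / (e - c), by push_cast [NNReal.coe_sub hce.le]; field_simp⟩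
  -- Everything not involving `h`, minus the allowance `(2 - 2θ) C = (1 - s) C`; at `s = 0` this is
  -- `M - C/2 < 0`.
  have hcont : Continuous fun s : ℝ =>
      ((1 - s) / 2 - s * k) * C + s * k * E + ((1 - s) * M + s * C) - (1 - s) * C := by fun_prop
  have hcont2 : Continuous fun s : ℝ => (1 - s) / 2 - s * k := by fun_prop
  have hev : ∀ᶠ s : ℝ in 𝓝 0,
      ((1 - s) / 2 - s * k) * C + s * k * E + ((1 - s) * M + s * C) - (1 - s) * C < 0 :=
    (hcont.tendsto 0).eventually (gt_mem_nhds (by norm_num; linarith))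
  have hev2 : ∀ᶠ s : ℝ in 𝓝 0, 0 < (1 - s) / 2 - s * k :=
    (hcont2.tendsto 0).eventually (lt_mem_nhds (by norm_num))
  obtain ⟨s, ⟨⟨hs1, hs3⟩, hs2⟩, hs0⟩ := ((hev.and hev2).and
    (gt_mem_nhds (zero_lt_one' ℝ)) |>.filter_mono (nhdsWithin_le_nhds (s := Ioi 0))
    |>.and self_mem_nhdsWithin).exists
  have hs0' : 0 < s := hs0
  lift s to ℝ≥0 using hs0'.le
  have hs2' : s ≤ 1 := by exact_mod_cast hs2.le
  have hs0'' : 0 < s := by exact_mod_cast hs0'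
  obtain ⟨x, hx⟩ : ∃ x : ℝ≥0, (x : ℝ) = (1 - s) / 2 - s * k := ⟨⟨_, hs3.le⟩, rfl⟩
  have hxs : (1 + s) / 2 + x + s * k = 1 := by
    rw [← NNReal.coe_inj]
    push_cast
    rw [hx]
    ring
  have hθ1 : (1 + s) / 2 ≤ 1 := by
    rw [div_le_one two_pos, ← one_add_one_eq_two]
    gcongr
  have hθ2 : 2 - 2 * ((1 + s) / 2) = 1 - s := by
    rw [mul_div_cancel₀ _ two_ne_zero, ← one_add_one_eq_two, add_tsub_add_eq_tsub_left]
  have e1 : (1 - s) * (c / 2) + s * c = (1 + s) / 2 * c := by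
    rw [← NNReal.coe_inj]
    push_cast [NNReal.coe_sub hs2']
    ring
  have h1 := φ.compl_convex (tsub_add_cancel_of_le hs2') (c / 2) c
  refine ⟨(1 + s) / 2, ?_, hθ1, fun h => ?_⟩
  · gcongr
    exact lt_add_of_pos_right _ hs0''
  · have h2 := φ.compl_convex_three hxs h c e
    have e2 : (1 + s) / 2 * h + x * c + s * k * e = (1 + s) / 2 * (c + h) := by
      rw [← NNReal.coe_inj]
      push_cast
      rw [hx]
      linear_combination (s : ℝ) * hk
    have h3 := φ.compl_mul_le ((1 + s) / 2) h hθ1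
    rw [e2, ← hC, ← hE] at h2
    rw [e1, ← hC, ← hM] at h1
    have h4 : (x : ℝ≥0∞) * C + ((s * k : ℝ≥0) : ℝ≥0∞) * E +
        (((1 - s : ℝ≥0) : ℝ≥0∞) * M + s * C) ≤ ((1 - s : ℝ≥0) : ℝ≥0∞) * C := by
      simp only [← ENNReal.coe_mul, ← ENNReal.coe_add, ENNReal.coe_le_coe]
      rw [← NNReal.coe_le_coe]
      push_cast [NNReal.coe_sub hs2']
      rw [hx]
      linarith
    rw [hθ2, ← hC]
    calc _ ≤ _ := add_le_add h2 (add_le_add h1 h3)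
      _ = 2 * ((1 + s) / 2 : ℝ≥0) * complementary φ.toFun h +
          ((x : ℝ≥0∞) * C + ((s * k : ℝ≥0) : ℝ≥0∞) * E +
            (((1 - s : ℝ≥0) : ℝ≥0∞) * M + s * C)) := by ring
      _ ≤ _ := by gcongr

/-- The estimate of `exists_compl_sum_le` at a real point, with both signs. -/
theorem compl_nnnorm_add_le (φ : OrliczFunction) (θ c : ℝ≥0) (r : ℝ) :
    complementary φ.toFun ‖(θ : ℝ) * (c + 1 * r)‖₊ +
      complementary φ.toFun ‖(θ : ℝ) * (c + (-1) * r)‖₊ ≤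
    complementary φ.toFun (θ * (c + ‖r‖₊)) + (complementary φ.toFun (θ * c)
        + complementary φ.toFun (θ * ‖r‖₊)) := by
  have hn : ∀ x : ℝ, ‖(θ : ℝ) * x‖₊ = θ * ‖x‖₊ := fun x => by
    rw [nnnorm_mul, NNReal.nnnorm_eq]
  -- Of `c + r` and `c - r`, one has absolute value at most `c + |r|` and the other at most `max c
  -- |r|`; the sign of `r` decides which. The value at a maximum is bounded by the sum of the two
  -- values.
  have key : ∀ a b : ℝ, |a| ≤ c + |r| → |b| ≤ max (c : ℝ) |r| →
      complementary φ.toFun ‖(θ : ℝ) * a‖₊ + complementary φ.toFun ‖(θ : ℝ) * b‖₊ ≤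
      complementary φ.toFun (θ * (c + ‖r‖₊)) + (complementary φ.toFun (θ * c)
        + complementary φ.toFun (θ * ‖r‖₊)) := by
    intro a b ha hb
    rw [hn, hn]
    have ha' : ‖a‖₊ ≤ c + ‖r‖₊ := by
      rw [← NNReal.coe_le_coe]; simpa using ha
    refine add_le_add (φ.compl_mono (by gcongr)) ?_
    rcases le_max_iff.mp hb with h | h
    · have h' : ‖b‖₊ ≤ c := by rw [← NNReal.coe_le_coe]; simpa using h
      exact le_add_right (φ.compl_mono (by gcongr))
    · have h' : ‖b‖₊ ≤ ‖r‖₊ := by rw [← NNReal.coe_le_coe]; simpa using h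
      exact le_add_left (φ.compl_mono (by gcongr))
  have hc : (0 : ℝ) ≤ c := c.2
  rcases le_total 0 r with hr | hr
  · refine key _ _ ?_ ?_
    · rw [abs_of_nonneg hr, abs_le]; constructor <;> linarith
    · rw [abs_of_nonneg hr, abs_le]
      have h1 := le_max_left (c : ℝ) r
      have h2 := le_max_right (c : ℝ) r
      constructor <;> linarith
  · rw [add_comm (complementary _ _)]
    refine key _ _ ?_ ?_
    · rw [abs_of_nonpos hr, abs_le]; constructor <;> linarith
    · rw [abs_of_nonpos hr, abs_le]
      have h1 := le_max_left (c : ℝ) (-r)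
      have h2 := le_max_right (c : ℝ) (-r)
      constructor <;> linarith

end OrliczFunction

/-! ### Norming indicator functions, and the two cases of the theorem. -/

namespace OrliczFunction

open Orlicz

variable {Ω : Type*} [MeasurableSpace Ω] {μ : Measure Ω} {φ : OrliczFunction}

namespace OrliczSpace

/-- Jensen's inequality bounds the Orlicz norm of an indicator function. -/
theorem norm_le_of_coe_eq_indicator {A : Set Ω} (hA : MeasurableSet A) {c : ℝ≥0}
    (hc : complementary φ.toFun c * μ A = 1) {f : φ.OrliczSpace μ}
    (hf : toAEEqFun f =ᵐ[μ] A.indicator fun _ => (1 : ℝ)) : ‖f‖ ≤ c * μ.real A := by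
  have hc0 : complementary φ.toFun c ≠ 0 := by rintro h; simp [h] at hc
  have hA0 : μ A ≠ 0 := by rintro h; simp [h] at hc
  have hctop : complementary φ.toFun c ≠ ∞ := by
    rintro h; rw [h, ENNReal.top_mul hA0] at hc; simp at hc
  have hAtop : μ A ≠ ∞ := by
    rintro h; rw [h, ENNReal.mul_top hc0] at hc; simp at hc
  refine norm_le_of _ fun h hh => ?_
  have hJ : ∫⁻ t, ‖toAEEqFun f t * h t‖ₑ ∂μ = ∫⁻ t in A, ‖h t‖ₑ ∂μ := by
    rw [← lintegral_indicator hA]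
    refine lintegral_congr_ae ?_
    filter_upwards [hf] with t ht
    rw [ht]
    by_cases htA : t ∈ A <;> simp [htA]
  obtain ⟨C, hC⟩ := lintegral_mul_le f
  have hJfin : ∫⁻ t in A, ‖h t‖ₑ ∂μ ≠ ∞ := by
    rw [← hJ]
    exact ne_top_of_le_ne_top ENNReal.coe_ne_top (hC h hh)
  have hu : ((∫⁻ t in A, ‖h t‖ₑ ∂μ) / μ A) ≠ ∞ := ENNReal.div_ne_top hJfin hA0
  -- Jensen: integrating Young's inequality over `A` for each fixed `v` shows that `φ_*` at the mean
  -- of `|h|` is at most `1/μ(A) = φ_*(c)`.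
  have hle : ((∫⁻ t in A, ‖h t‖ₑ ∂μ) / μ A).toNNReal ≤ c := by
    refine φ.le_of_compl_le hc0 hctop (iSup_le fun v => ?_)
    rw [ENNReal.coe_toNNReal hu, tsub_le_iff_left, div_eq_mul_inv, mul_right_comm,
      ← div_eq_mul_inv, ENNReal.div_le_iff hA0 hAtop, add_mul, hc, ← lintegral_mul_const' _ _ ENNReal.coe_ne_top]
    calc ∫⁻ t in A, ‖h t‖ₑ * v ∂μ
        ≤ ∫⁻ t in A, (φ.toFun v + complementary φ.toFun ‖h t‖₊) ∂μ := by
          refine lintegral_mono fun t => ?_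
          rw [enorm_eq_nnnorm, mul_comm, ← ENNReal.coe_mul]
          exact φ.young _ _
      _ = φ.toFun v * μ A + ∫⁻ t in A, complementary φ.toFun ‖h t‖₊ ∂μ := by
          rw [lintegral_add_left measurable_const, setLIntegral_const]
      _ ≤ φ.toFun v * μ A + 1 := by
          gcongr
          exact (setLIntegral_le_lintegral _ _).trans hh
  have hle' : ∫⁻ t in A, ‖h t‖ₑ ∂μ ≤ c * μ A := by
    rw [← ENNReal.div_le_iff hA0 hAtop, ← ENNReal.coe_toNNReal hu]
    exact_mod_cast hle
  refine (le_abs_self _).trans ?_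
  rw [← Real.norm_eq_abs]
  have h1 := (enorm_integral_le_lintegral_enorm fun t => toAEEqFun f t * h t).trans
    (hJ.le.trans hle')
  have h2 := ENNReal.toReal_mono (ENNReal.mul_ne_top ENNReal.coe_ne_top hAtop) h1
  rwa [ENNReal.toReal_mul, toReal_enorm] at h2

/-- The failure of the local diameter two property, witnessed by a multiple of an indicator
function. -/
theorem not_localDiameterTwoProperty_of_indicator [SigmaFinite μ] {A : Set Ω}
    (hA : MeasurableSet A) {c : ℝ≥0} (hc : complementary φ.toFun c * μ A = 1) {θ : ℝ≥0}
    (hθ : 1 / 2 < θ)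
    (H : ∀ h : Ω →ₘ[μ] ℝ, modular (complementary φ.toFun) μ h ≤ 1 →
      modular (complementary φ.toFun) μ
        (fun t => θ * (A.indicator (fun _ => (c : ℝ)) t + 1 * h t)) ≤ 1 ∨
      modular (complementary φ.toFun) μ
        (fun t => θ * (A.indicator (fun _ => (c : ℝ)) t + (-1) * h t)) ≤ 1) :
    ¬ LocalDiameterTwoProperty (φ.OrliczSpace μ) := by
  have hc0 : complementary φ.toFun c ≠ 0 := by rintro h; simp [h] at hc
  have hA0 : μ A ≠ 0 := by rintro h; simp [h] at hc
  have hAtop : μ A ≠ ∞ := by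
    rintro h; rw [h, ENNReal.mul_top hc0] at hc; simp at hc
  have hm : Measurable (A.indicator fun _ => (c : ℝ)) := measurable_const.indicator hA
  have hae := AEEqFun.coeFn_mk (μ := μ) _ hm.aestronglyMeasurable
  obtain ⟨f, hf⟩ := exists_coe_eq_indicator φ hA hAtop
  refine not_localDiameterTwoProperty (AEEqFun.mk _ hm.aestronglyMeasurable) ?_ f ?_ ?_
    (θ := θ) (by have : ((1 / 2 : ℝ≥0) : ℝ) < θ := by exact_mod_cast hθ
                 simpa using this) fun h hh => ?_
  · have e : modular (complementary φ.toFun) μ (A.indicator fun _ => (c : ℝ)) =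
        ∫⁻ t, A.indicator (fun _ => complementary φ.toFun c) t ∂μ := by
      refine lintegral_congr fun t => ?_
      by_cases htA : t ∈ A <;> simp [htA, φ.compl_zero]
    rw [modular_congr (hae.mono fun t ht => by rw [ht]), e, lintegral_indicator_const hA, hc]
  · rintro rfl
    refine hA0 (measure_eq_zero_iff_ae_notMem.mpr ?_)
    rw [map_zero] at hf
    filter_upwards [hf, AEEqFun.coeFn_zero (α := Ω) (β := ℝ) (μ := μ)] with t h1 h2 htA
    rw [h1] at h2
    simp [htA] at h2
  · refine (norm_le_of_coe_eq_indicator hA hc hf).trans_eq ?_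
    rw [integral_congr_ae (g := A.indicator fun _ => (c : ℝ)), integral_indicator_const _ hA,
      smul_eq_mul, mul_comm]
    filter_upwards [hf, hae] with t h1 h2
    rw [h1, h2]
    by_cases htA : t ∈ A <;> simp [htA]
  · refine (H h hh).imp (fun h1 => ?_) fun h1 => ?_ <;>
    · rw [modular_congr]
      · exact h1
      · filter_upwards [hae] with t ht
        rw [ht]

/-- Failure of the local diameter two property over a nonatomic measure. -/
theorem not_localDiameterTwoProperty_of_isNonatomic [SigmaFinite μ] (hμ : IsNonatomic μ)
    (hd : linearBound (complementary φ.toFun) < finiteBound (complementary φ.toFun))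
    (hb : 1 < Orlicz.extend (complementary φ.toFun) (finiteBound (complementary φ.toFun)) * μ univ) :
    ¬ LocalDiameterTwoProperty (φ.OrliczSpace μ) := by
  -- By left lower semicontinuity the value at `b` is approached strictly below `b`, so `c` can be
  -- taken with room to its right.
  have hext : Orlicz.extend (complementary φ.toFun) (finiteBound (complementary φ.toFun)) ≤
      ⨆ u : {u : ℝ≥0 // (u : ℝ≥0∞) < finiteBound (complementary φ.toFun)},
        complementary φ.toFun u := by
    unfold Orlicz.extend
    split_ifs with h
    · exact iSup_le fun u => le_iSup (fun u : {u : ℝ≥0 // (u : ℝ≥0∞) <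
        finiteBound (complementary φ.toFun)} => complementary φ.toFun u)
        ⟨u, h ▸ ENNReal.coe_lt_top⟩
    · refine le_of_forall_lt fun r hr => ?_
      obtain ⟨u, hu, hru⟩ := φ.exists_lt_compl hr
      exact lt_iSup_iff.mpr ⟨⟨u, by
        rw [← ENNReal.coe_toNNReal h]; exact_mod_cast hu⟩, hru⟩
  have hb' := hb.trans_le (mul_le_mul_left hext _)
  rw [ENNReal.iSup_mul, lt_iSup_iff] at hb'
  obtain ⟨⟨u, hub⟩, hu⟩ := hb'
  obtain ⟨c₁, hdc₁, hc₁b⟩ := ENNReal.lt_iff_exists_nnreal_btwn.mp hd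
  obtain ⟨c, hdc, hcb, hc⟩ : ∃ c : ℝ≥0, linearBound (complementary φ.toFun) < c ∧
      (c : ℝ≥0∞) < finiteBound (complementary φ.toFun) ∧
      1 < complementary φ.toFun c * μ univ := by
    refine ⟨max u c₁, hdc₁.trans_le (by exact_mod_cast le_max_right _ _), ?_, hu.trans_le ?_⟩
    · rcases max_choice u c₁ with h | h <;> rw [h] <;> assumption
    · gcongr
      exact φ.compl_mono (le_max_left _ _)
  obtain ⟨_, ⟨e, rfl, he⟩, hce⟩ := lt_sSup_iff.mp hcb
  have hce' : c < e := by exact_mod_cast hce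
  have hctop : complementary φ.toFun c ≠ ∞ := ne_top_of_le_ne_top he.ne (φ.compl_mono hce'.le)
  have hc0 : complementary φ.toFun c ≠ 0 := by rintro h; simp [h] at hc
  obtain ⟨θ, hθ, hθ1, H⟩ := φ.exists_compl_sum_le hce' he.ne (φ.compl_half_lt hdc hc0 hctop)
  -- Sigma-finiteness yields a set of finite measure above `1/φ_*(c)`, from which Sierpiński's
  -- theorem cuts `A` with measure exactly `1/φ_*(c)`.
  have hlt : (complementary φ.toFun c)⁻¹ < μ univ := by
    rw [← one_div]
    exact ENNReal.div_lt_of_lt_mul' hc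
  obtain ⟨A₀, hA₀, -, hA₀t, hA₀top⟩ :=
    Measure.exists_subset_measure_lt_top MeasurableSet.univ hlt
  obtain ⟨A, hA, -, hAt⟩ := hμ.exists_subset_measure_eq hA₀ hA₀top.ne hA₀t.le
  have hcA : complementary φ.toFun c * μ A = 1 := by
    rw [hAt, ENNReal.mul_inv_cancel hc0 hctop]
  refine not_localDiameterTwoProperty_of_indicator hA hcA hθ fun h hh => ?_
  by_contra! hcon
  have hm : Measurable (complementary φ.toFun) := φ.compl_mono.measurable
  -- On `A` the pointwise estimate applies; off `A` each sign costs at most `θ φ_*(|h|)`. The total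
  -- is at most `2θ + (2 - 2θ)`, so the two modulars cannot both exceed 1.
  have hsum : modular (complementary φ.toFun) μ
        (fun t => θ * (A.indicator (fun _ => (c : ℝ)) t + 1 * h t)) +
      modular (complementary φ.toFun) μ
        (fun t => θ * (A.indicator (fun _ => (c : ℝ)) t + (-1) * h t)) ≤ 2 := by
    unfold modular
    rw [← lintegral_add_left']
    · calc _ ≤ ∫⁻ t, (2 * θ * complementary φ.toFun ‖h t‖₊ + A.indicator (fun _ =>
            ((2 - 2 * θ : ℝ≥0) : ℝ≥0∞) * complementary φ.toFun c) t) ∂μ := by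
            refine lintegral_mono fun t => ?_
            by_cases htA : t ∈ A
            · simp only [indicator_of_mem htA]
              exact (φ.compl_nnnorm_add_le θ c (h t)).trans (H _)
            · have h0 := φ.compl_mul_le θ ‖h t‖₊ hθ1
              simp only [indicator_of_notMem htA, zero_add, one_mul, neg_one_mul, add_zero,
                nnnorm_mul, nnnorm_neg, NNReal.nnnorm_eq]
              refine (add_le_add h0 h0).trans_eq ?_
              ring
        _ = 2 * θ * modular (complementary φ.toFun) μ h + ((2 - 2 * θ : ℝ≥0) : ℝ≥0∞) := by
            rw [lintegral_add_right _ (measurable_const.indicator hA),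
              lintegral_indicator_const hA, mul_assoc ((2 - 2 * θ : ℝ≥0) : ℝ≥0∞), hcA, mul_one,
              lintegral_const_mul' _ _ (ENNReal.mul_ne_top ENNReal.ofNat_ne_top
                ENNReal.coe_ne_top)]
            rfl
        _ ≤ 2 * θ * 1 + ((2 - 2 * θ : ℝ≥0) : ℝ≥0∞) := by gcongr
        _ = 2 := by
            have h2 : 2 * θ + (2 - 2 * θ) = 2 :=
              add_tsub_cancel_of_le (mul_le_of_le_one_right zero_le hθ1)
            rw [mul_one]
            exact_mod_cast h2
    · refine hm.comp_aemeasurable (AEMeasurable.nnnorm ?_)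
      exact (((measurable_const.indicator hA).aemeasurable).add
        (h.aemeasurable.const_mul 1)).const_mul _
  refine hsum.not_gt ?_
  rw [← one_add_one_eq_two]
  exact ENNReal.add_lt_add hcon.1 hcon.2

/-- Failure of the local diameter two property for sequence spaces. -/
theorem not_localDiameterTwoProperty_count
    (hd : linearBound (complementary φ.toFun) < unitBound (complementary φ.toFun))
    (hc : Orlicz.extend (complementary φ.toFun) (unitBound (complementary φ.toFun)) = 1) :
    ¬ LocalDiameterTwoProperty (φ.OrliczSpace (Measure.count : Measure ℕ)) := by
  -- At infinity the extended value would be `∞`, not 1, because `φ_*` is unbounded.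
  have htop : unitBound (complementary φ.toFun) ≠ ∞ := by
    intro h
    rw [h, Orlicz.extend, if_pos rfl, φ.iSup_compl] at hc
    simp at hc
  obtain ⟨c, hcu⟩ : ∃ c : ℝ≥0, (c : ℝ≥0∞) = unitBound (complementary φ.toFun) :=
    ⟨_, ENNReal.coe_toNNReal htop⟩
  rw [← hcu] at hd
  rw [← hcu, Orlicz.extend, if_neg ENNReal.coe_ne_top, ENNReal.toNNReal_coe] at hc
  have hc0 : complementary φ.toFun c ≠ 0 := by simp [hc]
  have hctop : complementary φ.toFun c ≠ ∞ := by simp [hc]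
  -- Only values up to `c` are used, since `φ_*` may be infinite immediately to the right of `c`.
  obtain ⟨θ, hθ, hθ1, H⟩ := φ.exists_compl_mul_add_le hctop (φ.compl_half_lt hd hc0 hctop)
  rw [hc, mul_one] at H
  -- Coordinate `0` costs at most `φ_*(θ c)` and the others together at most `θ`; the choice of `θ`
  -- makes the sum at most 1.
  have key : ∀ (s : ℝ) (h : ℕ → ℝ), ‖s‖₊ = 1 →
      modular (complementary φ.toFun) Measure.count h ≤ 1 → |c + s * h 0| ≤ c →
      modular (complementary φ.toFun) Measure.count
        (fun t => θ * (({0} : Set ℕ).indicator (fun _ => (c : ℝ)) t + s * h t)) ≤ 1 := by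
    intro s h hs hh hch
    calc _ ≤ ∫⁻ t, (({0} : Set ℕ).indicator (fun _ => complementary φ.toFun (θ * c)) t +
          θ * complementary φ.toFun ‖h t‖₊) ∂Measure.count := by
          refine lintegral_mono fun t => ?_
          rcases eq_or_ne t 0 with rfl | ht
          · simp only [indicator_of_mem (mem_singleton (0 : ℕ))]
            refine le_add_right (φ.compl_mono ?_)
            rw [nnnorm_mul, NNReal.nnnorm_eq]
            gcongr
            rw [← NNReal.coe_le_coe]
            simpa using hch
          · have ht' : t ∉ ({0} : Set ℕ) := ht
            simp only [indicator_of_notMem ht', zero_add, nnnorm_mul, hs, one_mul,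
              NNReal.nnnorm_eq]
            exact φ.compl_mul_le θ _ hθ1
      _ = complementary φ.toFun (θ * c) + θ * modular (complementary φ.toFun) Measure.count h := by
          rw [lintegral_add_left (measurable_of_countable _),
            lintegral_indicator_const (measurableSet_singleton _), Measure.count_singleton, mul_one,
            lintegral_const_mul' _ _ ENNReal.coe_ne_top]
          rfl
      _ ≤ complementary φ.toFun (θ * c) + θ * 1 := by gcongr
      _ ≤ 1 := by rwa [mul_one]
  refine not_localDiameterTwoProperty_of_indicator (measurableSet_singleton 0) (c := c)
    (by rw [hc, Measure.count_singleton, mul_one]) hθ fun h hh => ?_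
  -- One coordinate contributes at most the whole modular, so `φ_*(|h 0|) ≤ 1 = φ_*(c)`. Then `c + h
  -- 0` or `c - h 0` lies in `[0, c]`, according to the sign of `h 0`.
  have h0 : ‖h 0‖₊ ≤ c := by
    refine φ.le_of_compl_le hc0 hctop ?_
    rw [hc]
    refine le_trans ?_ hh
    rw [modular, lintegral_count]
    exact ENNReal.le_tsum (f := fun t => complementary φ.toFun ‖h t‖₊) 0
  have h0' : |h 0| ≤ c := by
    rw [← NNReal.coe_le_coe] at h0; simpa using h0
  have hcn : (0 : ℝ) ≤ c := c.2
  rw [abs_le] at h0'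
  rcases le_total (h 0) 0 with hs | hs
  · refine Or.inl (key 1 h (by simp) hh ?_)
    rw [abs_le]; constructor <;> linarith
  · refine Or.inr (key (-1) h (by simp) hh ?_)
    rw [abs_le]; constructor <;> linarith

end OrliczSpace

end OrliczFunction

theorem mainTheorem8 {Ω : Type*} [MeasurableSpace Ω] (μ : Measure Ω) [SigmaFinite μ]
    (φ : OrliczFunction) :
    (Orlicz.IsNonatomic μ →
      Orlicz.linearBound (Orlicz.complementary φ.toFun) < Orlicz.finiteBound (Orlicz.complementary φ.toFun) →
      1 < Orlicz.extend (Orlicz.complementary φ.toFun) (Orlicz.finiteBound (Orlicz.complementary φ.toFun)) *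
        μ univ →
      ¬ LocalDiameterTwoProperty (φ.OrliczSpace μ)) ∧
    (Orlicz.linearBound (Orlicz.complementary φ.toFun) < Orlicz.unitBound (Orlicz.complementary φ.toFun) →
      Orlicz.extend (Orlicz.complementary φ.toFun) (Orlicz.unitBound (Orlicz.complementary φ.toFun)) = 1 →
      ¬ LocalDiameterTwoProperty (φ.OrliczSpace (Measure.count : Measure ℕ))) := by
  exact ⟨fun hμ hd hb => OrliczFunction.OrliczSpace.not_localDiameterTwoProperty_of_isNonatomic hμ hd hb,
    fun hd hc => OrliczFunction.OrliczSpace.not_localDiameterTwoProperty_count hd hc⟩
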